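/- Let $d\ge 2$ be an integer and $\lambda\in[0,1]$; let $\log=\log_2$, with $0\log 0=0$. On $\mathbb C^d\otimes\mathbb C^d$ (systems $A$, $B$) let $$\omega_{AB}=\lambda\Phi_d+\frac{1-\lambda}{d^2-1}(I-\Phi_d),\qquad \Phi_d=\frac1d\sum_{i,j=1}^{d}|ii\rangle\langle jj| ,$$ be the isotropic state. Let $P=\{|e_z\rangle\langle e_z|\}_{z=0}^{d-1}$ be the measurement of $A$ in an orthonormal basis $(e_z)$ of $\mathbb C^d$, and $Q=\{|f_x\rangle\langle f_x|\}_{x=0}^{d-1}$ the Fourier-conjugate measurement, $f_x=d^{-1/2}\sum_z e^{2\pi i xz/d}e_z$, and put $c(P,Q)=\max_{z,x}|\langle e_z|f_x\rangle|$. Let $S(\rho)=-\mathrm{Tr}(\rho\log\rho)$ be the von Neumann entropy, and write $S(A)$, $S(B)$, $S(AB)$ for the entropies of the reduced states and of the joint state. Put $S(A|B)=S(AB)-S(B)$ and $I(A;B)=S(A)+S(B)-S(AB)$. For a POVM $\Lambda=\{\Lambda_x\}$ on $A$ let $\rho_{\Lambda B}=\sum_x|x\rangle\langle x|\otimes \mathrm{Tr}_A\{(\Lambda_x\otimes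 I)\omega_{AB}\}$ and $S(\Lambda|B)=S(\rho_{\Lambda B})-S(\omega_B)$. The classical correlation is $J_A(\omega_{AB})=\max_{\Upsilon}I(X;B)_{\rho_{\Upsilon B}}$, where $\Upsilon$ runs over all POVMs on $A$ with finitely many outcomes and $X$ is the outcome register, and the quantum discord is $D_A(\omega_{AB})=I(A;B)-J_A(\omega_{AB})$. Then the maximum defining $J_A(\omega_{AB})$ is attained, and $$S(P|B)+S(Q|B)=-2\log c(P,Q)+S(A|B)+D_A(\omega_{AB})-J_A(\omega_{AB})=-\frac{2(d\lambda+1)}{d+1}\log\frac{d\lambda+1}{d+1}-\frac{2d(1-\lambda)}{d+1}\log\frac{d(1-\lambda)}{d^2-1}.$$ The same value is taken by the lower bound $-2\log c(P,Q)+S(A|B)+\max\{0,\,D_A(\omega_{AB})-J_A(\omega_{AB})\}$. Moreover, the lower bound of Berta et al. is $$-2\log c(P,Q)+S(A|B)=-\lambda\log\lambda-(1-\lambda)\log\frac{1-\lambda}{d^2-1}.$$ -/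

import Mathlib

open scoped Kronecker ComplexOrder

noncomputable section

namespace QMemory

variable {A B X : Type*} [Fintype A] [DecidableEq A] [Fintype B] [DecidableEq B]
  [Fintype X] [DecidableEq X]

/-- Von Neumann entropy in bits, `S(ρ) = -Tr(ρ log₂ ρ)`; the logarithm of a Hermitian matrix is
taken by functional calculus, and `Real.logb 2 0 = 0` gives the convention `0 log 0 = 0`. -/
def vonNeumannEntropy (ρ : Matrix A A ℂ) : ℝ :=
  -(Matrix.trace (ρ * cfc (Real.logb 2) ρ)).re

/-- Partial trace over the first tensor factor, `Tr_A : A ⊗ B → B`. -/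
def traceFst (M : Matrix (A × B) (A × B) ℂ) : Matrix B B ℂ :=
  Matrix.of fun b b' => ∑ a, M (a, b) (a, b')

/-- Partial trace over the second tensor factor, `Tr_B : A ⊗ B → A`. -/
def traceSnd (M : Matrix (A × B) (A × B) ℂ) : Matrix A A ℂ :=
  Matrix.of fun a a' => ∑ b, M (a, b) (a', b)

/-- Conditional entropy `S(A|B) = S(AB) - S(B)`. -/
def condEntropy (ρ : Matrix (A × B) (A × B) ℂ) : ℝ :=
  vonNeumannEntropy ρ - vonNeumannEntropy (traceFst ρ)

/-- Mutual information `I(A;B) = S(A) + S(B) - S(AB)`. -/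
def mutualInfo (ρ : Matrix (A × B) (A × B) ℂ) : ℝ :=
  vonNeumannEntropy (traceSnd ρ) + vonNeumannEntropy (traceFst ρ) - vonNeumannEntropy ρ

/-- A positive operator-valued measure with outcomes in `X`. -/
structure IsPOVM (Λ : X → Matrix A A ℂ) : Prop where
  posSemidef : ∀ x, (Λ x).PosSemidef
  sum_eq_one : ∑ x, Λ x = 1

/-- The state `∑ x, |x⟩⟨x| ⊗ Tr_A((Λ x ⊗ I) ρ)` of the outcome register and the memory after `Λ`
has been measured on the first system. -/
def postMeasurement (Λ : X → Matrix A A ℂ) (ρ : Matrix (A × B) (A × B) ℂ) :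
    Matrix (X × B) (X × B) ℂ :=
  ∑ x, Matrix.single x x (1 : ℂ) ⊗ₖ traceFst ((Λ x ⊗ₖ (1 : Matrix B B ℂ)) * ρ)

/-- `S(P|B) = S(ρ_PB) - S(ρ_B)`: the uncertainty about the outcome of `P` given the memory. -/
def uncertainty (P : X → Matrix A A ℂ) (ρ : Matrix (A × B) (A × B) ℂ) : ℝ :=
  vonNeumannEntropy (postMeasurement P ρ) - vonNeumannEntropy (traceFst ρ)

/-- All values `I(X;B)` reached by POVMs on the first system, with any finite number of outcomes. -/
def accessibleInfo (ρ : Matrix (A × B) (A × B) ℂ) : Set ℝ :=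
  {r | ∃ (n : ℕ) (Υ : Fin n → Matrix A A ℂ), IsPOVM Υ ∧ r = mutualInfo (postMeasurement Υ ρ)}

/-- Classical correlation `J_A(ρ)`, the largest `I(X;B)` over all POVMs on the first system. -/
def classicalCorrelation (ρ : Matrix (A × B) (A × B) ℂ) : ℝ :=
  sSup (accessibleInfo ρ)

/-- Quantum discord `D_A(ρ) = I(A;B) - J_A(ρ)`. -/
def discord (ρ : Matrix (A × B) (A × B) ℂ) : ℝ :=
  mutualInfo ρ - classicalCorrelation ρ

/-- The measurement `{|v x⟩⟨v x|}` attached to a family of vectors. -/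
def rankOneMeasurement (v : X → EuclideanSpace ℂ A) : X → Matrix A A ℂ :=
  fun x => Matrix.vecMulVec (fun a => v x a) (fun a => star (v x a))

/-- Incompatibility `c = max_{i,j} |⟨p_i|q_j⟩|` of two families of measurement vectors. -/
def incompatibility {Y : Type*} (p : X → EuclideanSpace ℂ A) (q : Y → EuclideanSpace ℂ A) : ℝ :=
  ⨆ ij : X × Y, ‖inner ℂ (p ij.1) (q ij.2)‖

/-- The basis that is Fourier-conjugate to `e`: `|x̃⟩ = d^{-1/2} ∑ z, exp(2πi x z / d) |e z⟩`. -/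
def fourierConjugate {d : ℕ} (e : Fin d → EuclideanSpace ℂ (Fin d)) :
    Fin d → EuclideanSpace ℂ (Fin d) :=
  fun x => ((1 / Real.sqrt d : ℝ) : ℂ) •
    ∑ z : Fin d, Complex.exp (2 * Real.pi * Complex.I * (x : ℕ) * (z : ℕ) / d) • e z

/-- The maximally entangled state `Φ_d = (1/d) ∑ i j, |i i⟩⟨j j|`. -/
def maxEntangled (d : ℕ) : Matrix (Fin d × Fin d) (Fin d × Fin d) ℂ :=
  Matrix.of fun p q => if p.1 = p.2 ∧ q.1 = q.2 then 1 / (d : ℂ) else 0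

/-- The isotropic state `λ Φ_d + (1 - λ) / (d² - 1) (I - Φ_d)`. -/
def isotropic (d : ℕ) (lam : ℝ) : Matrix (Fin d × Fin d) (Fin d × Fin d) ℂ :=
  (lam : ℂ) • maxEntangled d
    + (((1 - lam) / ((d : ℝ) ^ 2 - 1) : ℝ) : ℂ) • (1 - maxEntangled d)

end QMemory

end

/-!
# The entropic uncertainty bound with discord is tight for isotropic states

Write `ω = μ I + (λ - μ) Φ` with `μ = (1 - λ) / (d² - 1)`. An operator `M` on the first system
leaves `Tr_A((M ⊗ I) ω) = μ tr(M) I + ((λ - μ) / d) Mᵀ` on the second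
(`traceFst_kronecker_one_mul_isotropic`). So the state after a measurement is block diagonal with
explicitly known blocks, and every entropy in question is a sum of `-x log x` over eigenvalues.
For a measurement by unit vectors all blocks have the same spectrum, whichever the vectors are, so
the uncertainties of `P` and `Q` are equal.

The classical correlation is where an optimisation is needed
(`mutualInfo_postMeasurement_isotropic_le`). For an effect `Λ x` of trace `t`, the eigenvalues of
the block are affine in those of `Λ x`, which lie in `[0, t]` and sum to `t`. Concavity of `-x log
x` bounds the entropy of the block from below by its value when `Λ x` is `t` times a rank-one
projection (`le_vonNeumannEntropy_smul_one_add_smul`). In that bound the dependence on `t` is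
exactly the entropy of the outcome register, which cancels in the mutual information; only `∑ t =
d` remains. Any orthonormal basis therefore attains the maximum, `J = log d - S(P|B)`. As both
marginals of `ω` are maximally mixed and `c(P,Q) = 1 / √d`, the lower bound without the maximum is
`2 (log d - J)`, which is the uncertainty sum.

For the bound with `max {0, D - J}` one needs `D ≥ J`, that is `S(ω) ≤ S(P|B) + S(Q|B)`. This is
subadditivity of the Shannon entropy for the spectrum of `ω`, read as a distribution on a `d × d`
grid (`negMulLog_add_le_two_mul`).
-/

namespace QMemory

open Real Matrix

section Entropy

variable {A B X : Type*} [Fintype A] [DecidableEq A] [Fintype B] [DecidableEq B]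
  [Fintype X] [DecidableEq X]

/-! ### Von Neumann entropy through diagonalisation -/

theorem isHermitian_conj_diagonal (V : Matrix A A ℂ) (c : A → ℝ) :
    (V * diagonal (fun i => (c i : ℂ)) * Vᴴ).IsHermitian := by
  apply isHermitian_mul_mul_conjTranspose
  rw [IsHermitian, diagonal_conjTranspose]
  congr 1
  ext i
  simp

theorem vonNeumannEntropy_eq_sum_eigenvalues {ρ : Matrix A A ℂ} (hρ : ρ.IsHermitian) :
    vonNeumannEntropy ρ = (∑ i, negMulLog (hρ.eigenvalues i)) / log 2 := by
  have h1 : ρ * cfc (Real.logb 2) ρ = hρ.cfc (fun x => x * Real.logb 2 x) := by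
    conv_lhs => rw [hρ.cfc_eq, IsHermitian.cfc]
    nth_rewrite 1 [hρ.spectral_theorem]
    rw [← map_mul, diagonal_mul_diagonal, IsHermitian.cfc]
    congr 2
    ext i
    simp
  rw [vonNeumannEntropy, h1, IsHermitian.cfc, Unitary.conjStarAlgAut_apply, trace_mul_cycle]
  have h2 : (trace (diagonal (RCLike.ofReal ∘ (fun x => x * Real.logb 2 x) ∘ hρ.eigenvalues) :
      Matrix A A ℂ)).re = ∑ i, hρ.eigenvalues i * Real.logb 2 (hρ.eigenvalues i) := by
    simp [trace_diagonal]
  rw [Unitary.coe_star_mul_self, one_mul, h2]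
  simp only [negMulLog, Real.logb, ← Finset.sum_neg_distrib, Finset.sum_div]
  exact Finset.sum_congr rfl fun i _ => by ring

/-- The entropy of an explicitly diagonalised matrix. -/
theorem vonNeumannEntropy_conj_diagonal {V : Matrix A A ℂ} (hV : Vᴴ * V = 1) (c : A → ℝ) :
    vonNeumannEntropy (V * diagonal (fun i => (c i : ℂ)) * Vᴴ)
      = (∑ i, negMulLog (c i)) / log 2 := by
  have hρ := isHermitian_conj_diagonal V c
  rw [vonNeumannEntropy_eq_sum_eigenvalues hρ]
  have h1 := hρ.roots_charpoly_eq_eigenvalues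
  have h2 : (V * diagonal (fun i => (c i : ℂ)) * Vᴴ).charpoly.roots
      = Multiset.map (fun i => (c i : ℂ)) Finset.univ.val := by
    rw [charpoly_mul_comm, ← mul_assoc, hV, one_mul, charpoly_diagonal]
    simpa [Finset.prod_map_val] using
      Polynomial.roots_multiset_prod_X_sub_C (Multiset.map (fun i => (c i : ℂ)) Finset.univ.val)
  have h3 := congrArg (fun s => (Multiset.map (fun z : ℂ => negMulLog z.re) s).sum)
    (h1.symm.trans h2)
  simp only [Multiset.map_map, Function.comp_def] at h3
  congr 1

theorem vonNeumannEntropy_diagonal (c : A → ℝ) :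
    vonNeumannEntropy (diagonal (fun i => (c i : ℂ))) = (∑ i, negMulLog (c i)) / log 2 := by
  simpa using vonNeumannEntropy_conj_diagonal (V := (1 : Matrix A A ℂ)) (by simp) c

theorem exists_diagonalization {H : Matrix A A ℂ} (hH : H.IsHermitian) :
    ∃ V : Matrix A A ℂ, Vᴴ * V = 1 ∧ V * Vᴴ = 1 ∧
      H = V * diagonal (fun i => (hH.eigenvalues i : ℂ)) * Vᴴ := by
  refine ⟨hH.eigenvectorUnitary, ?_, ?_, ?_⟩
  · exact Unitary.coe_star_mul_self hH.eigenvectorUnitary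
  · exact Unitary.coe_mul_star_self hH.eigenvectorUnitary
  · conv_lhs => rw [hH.spectral_theorem, Unitary.conjStarAlgAut_apply]
    rfl

theorem vonNeumannEntropy_smul_one_add_smul {H : Matrix A A ℂ} (hH : H.IsHermitian) (a b : ℝ) :
    vonNeumannEntropy ((a : ℂ) • (1 : Matrix A A ℂ) + (b : ℂ) • H)
      = (∑ i, negMulLog (a + b * hH.eigenvalues i)) / log 2 := by
  obtain ⟨V, hV, hV', h⟩ := exists_diagonalization hH
  rw [← vonNeumannEntropy_conj_diagonal hV]
  congr 1
  have : diagonal (fun i => ((a + b * hH.eigenvalues i : ℝ) : ℂ))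
      = (a : ℂ) • (1 : Matrix A A ℂ) + (b : ℂ) • diagonal (fun i => (hH.eigenvalues i : ℂ)) := by
    ext i j
    by_cases hij : i = j <;> simp [hij]
  rw [this, mul_add, add_mul, mul_smul_comm, smul_mul_assoc, mul_one, hV', mul_smul_comm,
    smul_mul_assoc, ← h]

/-! ### Block-diagonal matrices -/

theorem sum_single_kronecker_apply {ι κ : Type*} [Fintype ι] [DecidableEq ι]
    (M : ι → Matrix κ κ ℂ) (p q : ι × κ) :
    (∑ x, Matrix.single x x (1 : ℂ) ⊗ₖ M x) p q = if p.1 = q.1 then M p.1 p.2 q.2 else 0 := by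
  rw [Matrix.sum_apply, Finset.sum_eq_single p.1]
  · by_cases h : p.1 = q.1
    · simp [kroneckerMap_apply, ← h]
    · simp [kroneckerMap_apply, h]
  · intro x _ hx
    simp [kroneckerMap_apply, hx]
  · simp

theorem sum_single_kronecker_mul {ι κ : Type*} [Fintype ι] [DecidableEq ι] [Fintype κ]
    (M N : ι → Matrix κ κ ℂ) :
    (∑ x, Matrix.single x x (1 : ℂ) ⊗ₖ M x) * (∑ x, Matrix.single x x (1 : ℂ) ⊗ₖ N x)
      = ∑ x, Matrix.single x x (1 : ℂ) ⊗ₖ (M x * N x) := by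
  ext p q
  rw [mul_apply, Fintype.sum_prod_type, Finset.sum_eq_single p.1]
  · by_cases h : p.1 = q.1 <;> simp [sum_single_kronecker_apply, h, mul_apply]
  · intro x _ hx
    simp [sum_single_kronecker_apply, hx.symm]
  · simp

/-- The entropy of a block-diagonal matrix is the sum of the entropies of its blocks (no
normalisation of the blocks is involved). -/
theorem vonNeumannEntropy_sum_single_kronecker {M : X → Matrix B B ℂ}
    (hM : ∀ x, (M x).IsHermitian) :
    vonNeumannEntropy (∑ x, Matrix.single x x (1 : ℂ) ⊗ₖ M x) = ∑ x, vonNeumannEntropy (M x) := by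
  choose V hV _ h using fun x => exists_diagonalization (hM x)
  have hstar : (∑ x, Matrix.single x x (1 : ℂ) ⊗ₖ V x)ᴴ
      = ∑ x, Matrix.single x x (1 : ℂ) ⊗ₖ (V x)ᴴ := by
    simp [conjTranspose_sum, conjTranspose_kronecker]
  have hone : (∑ x : X, Matrix.single x x (1 : ℂ) ⊗ₖ (1 : Matrix B B ℂ)) = 1 := by
    ext ⟨x, b⟩ ⟨y, c⟩
    rw [sum_single_kronecker_apply]
    by_cases hxy : x = y
    · subst hxy
      by_cases hbc : b = c <;> simp [one_apply, hbc]
    · simp [hxy]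
  have hdiag : diagonal (fun p : X × B => (((hM p.1).eigenvalues p.2 : ℝ) : ℂ))
      = ∑ x, Matrix.single x x (1 : ℂ) ⊗ₖ diagonal (fun i => ((hM x).eigenvalues i : ℂ)) := by
    ext ⟨x, b⟩ ⟨y, c⟩
    rw [sum_single_kronecker_apply]
    by_cases hxy : x = y
    · subst hxy
      by_cases hbc : b = c <;> simp [hbc]
    · simp [hxy]
  have key := vonNeumannEntropy_conj_diagonal (V := ∑ x, Matrix.single x x (1 : ℂ) ⊗ₖ V x)
    (by rw [hstar, sum_single_kronecker_mul]; simp only [hV]; exact hone)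
    (fun p : X × B => (hM p.1).eigenvalues p.2)
  rw [hdiag, hstar, sum_single_kronecker_mul, sum_single_kronecker_mul] at key
  simp only [← h] at key
  rw [key, Fintype.sum_prod_type, Finset.sum_div]
  exact Finset.sum_congr rfl fun x _ => (vonNeumannEntropy_eq_sum_eigenvalues (hM x)).symm

/-! ### Affine images of positive semidefinite matrices -/

theorem sum_eigenvalues_eq {H : Matrix A A ℂ} (hH : H.IsHermitian) {t : ℝ}
    (ht : H.trace = t) : ∑ i, hH.eigenvalues i = t := by
  have h := hH.trace_eq_sum_eigenvalues
  rw [ht] at h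
  have h' : ((t : ℝ) : ℂ) = ((∑ i, hH.eigenvalues i : ℝ) : ℂ) := by simpa using h
  exact (Complex.ofReal_injective h').symm

/-- A rank-one projection has the eigenvalue one once and zero otherwise. -/
theorem vonNeumannEntropy_smul_one_add_smul_proj {H : Matrix A A ℂ} (hH : H.IsHermitian)
    (hHH : H * H = H) (htr : H.trace = 1) (a b : ℝ) :
    vonNeumannEntropy ((a : ℂ) • (1 : Matrix A A ℂ) + (b : ℂ) • H)
      = (negMulLog (a + b) + (Fintype.card A - 1) * negMulLog a) / log 2 := by
  rw [vonNeumannEntropy_smul_one_add_smul hH]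
  have hsum : ∑ i, hH.eigenvalues i = 1 := sum_eigenvalues_eq hH (by simpa using htr)
  have h01 : ∀ i, hH.eigenvalues i = 0 ∨ hH.eigenvalues i = 1 := by
    intro i
    have := (show IsIdempotentElem H from hHH).spectrum_subset ℝ
      (hH.eigenvalues_mem_spectrum_real i)
    simpa using this
  have h : ∀ i, negMulLog (a + b * hH.eigenvalues i)
      = negMulLog a + hH.eigenvalues i * (negMulLog (a + b) - negMulLog a) := by
    intro i
    rcases h01 i with h | h <;> simp [h]
  rw [Finset.sum_congr rfl fun i _ => h i, Finset.sum_add_distrib, ← Finset.sum_mul, hsum]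
  simp only [Finset.sum_const, Finset.card_univ, nsmul_eq_mul]
  ring

/-- The graph of `-x log x` lies above its chord between `t * a` and `t * (a + b)`. -/
theorem chord_le_negMulLog {a b t s : ℝ} (ha : 0 ≤ a) (hab : 0 ≤ a + b) (ht : 0 < t)
    (hs : 0 ≤ s) (hst : s ≤ t) :
    negMulLog (t * a) + s / t * (negMulLog (t * (a + b)) - negMulLog (t * a))
      ≤ negMulLog (t * a + b * s) := by
  have h := concaveOn_negMulLog.2 (show t * a ∈ Set.Ici 0 from Set.mem_Ici.2 (by positivity))
    (show t * (a + b) ∈ Set.Ici 0 from Set.mem_Ici.2 (by positivity))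
    (sub_nonneg.2 ((div_le_one ht).2 hst)) (div_nonneg hs ht.le) (sub_add_cancel 1 (s / t))
  simp only [smul_eq_mul] at h
  have e : (1 - s / t) * (t * a) + s / t * (t * (a + b)) = t * a + b * s := by
    field_simp
    ring
  rw [e] at h
  linarith

/-- Among the positive semidefinite matrices of a given trace, multiples of rank-one projections
minimise the entropy of an affine image: this is concavity of `-x log x` on each eigenvalue. -/
theorem le_vonNeumannEntropy_smul_one_add_smul {H : Matrix A A ℂ} (hH : H.PosSemidef) {t : ℝ}
    (htr : H.trace = t) {a b : ℝ} (ha : 0 ≤ a) (hab : 0 ≤ a + b) :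
    (negMulLog (t * (a + b)) + (Fintype.card A - 1) * negMulLog (t * a)) / log 2
      ≤ vonNeumannEntropy (((t * a : ℝ) : ℂ) • (1 : Matrix A A ℂ) + (b : ℂ) • H) := by
  rw [vonNeumannEntropy_smul_one_add_smul hH.1]
  have hsum : ∑ i, hH.1.eigenvalues i = t := sum_eigenvalues_eq hH.1 htr
  have h0 := hH.eigenvalues_nonneg
  have hle : ∀ i, hH.1.eigenvalues i ≤ t := fun i =>
    hsum ▸ Finset.single_le_sum (fun j _ => h0 j) (Finset.mem_univ i)
  have ht0 : 0 ≤ t := hsum ▸ Finset.sum_nonneg fun i _ => h0 i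
  refine div_le_div_of_nonneg_right ?_ (log_nonneg one_le_two)
  rcases ht0.eq_or_lt with rfl | ht
  · have : ∀ i, hH.1.eigenvalues i = 0 := fun i => le_antisymm (hle i) (h0 i)
    simp [this]
  · refine le_trans (le_of_eq ?_) (Finset.sum_le_sum fun i _ =>
      chord_le_negMulLog ha hab ht (h0 i) (hle i))
    rw [Finset.sum_add_distrib, ← Finset.sum_mul, ← Finset.sum_div, hsum, div_self ht.ne']
    simp only [Finset.sum_const, Finset.card_univ, nsmul_eq_mul]
    ring

end Entropy

/-! ### Rank-one measurements -/

section Measurements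

variable {A : Type*} [Fintype A]

theorem star_dotProduct_self_of_norm_eq_one {v : EuclideanSpace ℂ A} (hv : ‖v‖ = 1) :
    star (v : A → ℂ) ⬝ᵥ (v : A → ℂ) = 1 := by
  have h : inner ℂ v v = (1 : ℂ) := by
    rw [inner_self_eq_norm_sq_to_K, hv]
    simp
  rw [EuclideanSpace.inner_eq_star_dotProduct, dotProduct_comm] at h
  exact h

theorem rankOneMeasurement_apply {A X : Type*} (v : X → EuclideanSpace ℂ A) (x : X) :
    rankOneMeasurement v x = vecMulVec (v x : A → ℂ) (star (v x : A → ℂ)) := rfl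

theorem trace_rankOneMeasurement {X : Type*} {v : X → EuclideanSpace ℂ A} {x : X}
    (hv : ‖v x‖ = 1) : (rankOneMeasurement v x).trace = 1 := by
  rw [rankOneMeasurement_apply, trace_vecMulVec, dotProduct_comm,
    star_dotProduct_self_of_norm_eq_one hv]

theorem rankOneMeasurement_mul_self {X : Type*} {v : X → EuclideanSpace ℂ A} {x : X}
    (hv : ‖v x‖ = 1) :
    rankOneMeasurement v x * rankOneMeasurement v x = rankOneMeasurement v x := by
  rw [rankOneMeasurement_apply, vecMulVec_mul_vecMulVec, star_dotProduct_self_of_norm_eq_one hv]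
  simp

theorem isPOVM_rankOneMeasurement [DecidableEq A] {X : Type*} [Fintype X]
    (e : OrthonormalBasis X ℂ (EuclideanSpace ℂ A)) : IsPOVM (rankOneMeasurement e) where
  posSemidef x := posSemidef_vecMulVec_self_star _
  sum_eq_one := by
    ext a a'
    have h := e.sum_inner_mul_inner (EuclideanSpace.single a 1) (EuclideanSpace.single a' 1)
    simp only [EuclideanSpace.inner_single_left, EuclideanSpace.inner_single_right] at h
    simpa [Matrix.sum_apply, rankOneMeasurement, vecMulVec_apply, one_apply, eq_comm] using h

end Measurements

/-! ### Fourier-conjugate bases -/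

section Fourier

variable {d : ℕ}

/-- An orthonormal basis and its Fourier conjugate are mutually unbiased. -/
theorem norm_inner_fourierConjugate (e : OrthonormalBasis (Fin d) ℂ (EuclideanSpace ℂ (Fin d)))
    (z x : Fin d) : ‖inner ℂ (e z) (fourierConjugate e x)‖ = 1 / √d := by
  rw [fourierConjugate, inner_smul_right, e.orthonormal.inner_right_fintype, norm_mul]
  have : (2 * π * Complex.I * (x : ℕ) * (z : ℕ) / d : ℂ)
      = ((2 * π * (x : ℕ) * (z : ℕ) / d : ℝ) : ℂ) * Complex.I := by
    push_cast
    ring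
  rw [this, Complex.norm_exp_ofReal_mul_I, Complex.norm_real, mul_one,
    Real.norm_of_nonneg (by positivity)]

theorem norm_fourierConjugate (e : OrthonormalBasis (Fin d) ℂ (EuclideanSpace ℂ (Fin d)))
    (x : Fin d) : ‖fourierConjugate e x‖ = 1 := by
  have hd : (d : ℝ) ≠ 0 := Nat.cast_ne_zero.2 x.pos.ne'
  have h := e.sum_sq_norm_inner_right (fourierConjugate e x)
  simp only [norm_inner_fourierConjugate, div_pow, sq_sqrt (Nat.cast_nonneg d)] at h
  simp only [Finset.sum_const, Finset.card_univ, Fintype.card_fin, nsmul_eq_mul, one_pow,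
    mul_one_div_cancel hd] at h
  exact (pow_eq_one_iff_of_nonneg (norm_nonneg _) two_ne_zero).1 h.symm

theorem incompatibility_fourierConjugate [NeZero d]
    (e : OrthonormalBasis (Fin d) ℂ (EuclideanSpace ℂ (Fin d))) :
    incompatibility e (fourierConjugate e) = 1 / √d := by
  simp only [incompatibility, norm_inner_fourierConjugate, ciSup_const]

end Fourier

/-! ### The isotropic state -/

section Isotropic

variable {d : ℕ} {lam : ℝ}

/-- The eigenvalue `(1 - λ) / (d² - 1)` of the isotropic state on the orthogonal complement of the
maximally entangled vector. -/
noncomputable def noiseWeight (d : ℕ) (lam : ℝ) : ℝ := (1 - lam) / ((d : ℝ) ^ 2 - 1)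

theorem noiseWeight_nonneg (hd : 2 ≤ d) (h : lam ≤ 1) : 0 ≤ noiseWeight d lam := by
  have : (2 : ℝ) ≤ d := by exact_mod_cast hd
  exact div_nonneg (by linarith) (by nlinarith)

theorem noiseWeight_mul (hd : 2 ≤ d) : ((d : ℝ) ^ 2 - 1) * noiseWeight d lam = 1 - lam := by
  have : (2 : ℝ) ≤ d := by exact_mod_cast hd
  exact mul_div_cancel₀ _ (by nlinarith)

theorem d_mul_noiseWeight_add (hd : 2 ≤ d) :
    d * noiseWeight d lam + (lam - noiseWeight d lam) / d = 1 / d := by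
  have : (2 : ℝ) ≤ d := by exact_mod_cast hd
  have h := noiseWeight_mul (lam := lam) hd
  field_simp
  linarith

theorem noiseWeight_add (hd : 2 ≤ d) :
    noiseWeight d lam + (lam - noiseWeight d lam) / d = (d * lam + 1) / (d + 1) / d := by
  have : (2 : ℝ) ≤ d := by exact_mod_cast hd
  have h := noiseWeight_mul (lam := lam) hd
  field_simp
  linarith

theorem isotropic_eq (d : ℕ) (lam : ℝ) :
    isotropic d lam = (noiseWeight d lam : ℂ) • (1 : Matrix (Fin d × Fin d) (Fin d × Fin d) ℂ)
      + ((lam - noiseWeight d lam : ℝ) : ℂ) • maxEntangled d := by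
  rw [isotropic, ← noiseWeight, smul_sub, Complex.ofReal_sub, sub_smul]
  abel

theorem isHermitian_maxEntangled : (maxEntangled d).IsHermitian := by
  ext p q
  by_cases hp : p.1 = p.2 <;> by_cases hq : q.1 = q.2 <;> simp [maxEntangled, hp, hq]

theorem trace_maxEntangled [NeZero d] : (maxEntangled d).trace = 1 := by
  simp [maxEntangled, trace, Fintype.sum_prod_type]

theorem maxEntangled_mul_self [NeZero d] : maxEntangled d * maxEntangled d = maxEntangled d := by
  ext p q
  rw [mul_apply, Fintype.sum_prod_type]
  have hd : (d : ℂ) ≠ 0 := NeZero.ne _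
  by_cases hp : p.1 = p.2 <;> by_cases hq : q.1 = q.2 <;> simp [maxEntangled, hp, hq, hd]

/-- Applying `M` to the first half of the isotropic state leaves the transpose of `M`, mixed with
white noise, on the second half. -/
theorem traceFst_kronecker_one_mul_isotropic (M : Matrix (Fin d) (Fin d) ℂ) :
    traceFst ((M ⊗ₖ (1 : Matrix (Fin d) (Fin d) ℂ)) * isotropic d lam)
      = (M.trace * noiseWeight d lam) • (1 : Matrix (Fin d) (Fin d) ℂ)
        + (((lam - noiseWeight d lam) / d : ℝ) : ℂ) • Mᵀ := by
  rw [isotropic_eq]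
  generalize noiseWeight d lam = μ
  ext b b'
  have hΦ : ∑ a, ((M ⊗ₖ (1 : Matrix (Fin d) (Fin d) ℂ)) * maxEntangled d) (a, b) (a, b')
      = M b' b / d := by
    simp [mul_apply, Fintype.sum_prod_type, maxEntangled, kroneckerMap_apply, one_apply, ite_and,
      div_eq_mul_inv]
  have h1 : ∑ a, (M ⊗ₖ (1 : Matrix (Fin d) (Fin d) ℂ)) (a, b) (a, b')
      = M.trace * (1 : Matrix (Fin d) (Fin d) ℂ) b b' := by
    simp [trace, kroneckerMap_apply, Finset.sum_mul]
  rw [traceFst, of_apply]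
  simp only [mul_add, mul_smul_comm, mul_one, Matrix.add_apply, Matrix.smul_apply,
    Finset.sum_add_distrib, smul_eq_mul,
    ← Finset.mul_sum, hΦ, h1, transpose_apply]
  push_cast
  ring

theorem traceFst_isotropic (hd : 2 ≤ d) :
    traceFst (isotropic d lam) = diagonal fun _ => ((1 / d : ℝ) : ℂ) := by
  have h := traceFst_kronecker_one_mul_isotropic (lam := lam) (1 : Matrix (Fin d) (Fin d) ℂ)
  rw [one_kronecker_one, one_mul, trace_one, Fintype.card_fin, transpose_one, ← add_smul] at h
  rw [h, ← d_mul_noiseWeight_add (lam := lam) hd, smul_one_eq_diagonal]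
  push_cast
  rfl

theorem traceSnd_isotropic (hd : 2 ≤ d) :
    traceSnd (isotropic d lam) = diagonal fun _ => ((1 / d : ℝ) : ℂ) := by
  rw [← traceFst_isotropic (lam := lam) hd]
  -- The isotropic state is invariant under exchange of the two systems.
  have hsymm : ∀ p q, isotropic d lam p.swap q.swap = isotropic d lam p q := by
    intro p q
    simp [isotropic_eq, maxEntangled, one_apply, eq_comm]
  ext a a'
  change ∑ b, isotropic d lam (a, b) (a', b) = ∑ b, isotropic d lam (b, a) (b, a')
  exact Finset.sum_congr rfl fun b _ => (hsymm (a, b) (a', b)).symm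

theorem vonNeumannEntropy_maximallyMixed (hd : 2 ≤ d) :
    vonNeumannEntropy (diagonal fun _ : Fin d => ((1 / d : ℝ) : ℂ)) = log d / log 2 := by
  have : (d : ℝ) ≠ 0 := by positivity
  rw [vonNeumannEntropy_diagonal]
  simp [negMulLog, this]

theorem vonNeumannEntropy_isotropic (hd : 2 ≤ d) :
    vonNeumannEntropy (isotropic d lam)
      = (negMulLog lam + ((d : ℝ) ^ 2 - 1) * negMulLog (noiseWeight d lam)) / log 2 := by
  have : NeZero d := ⟨by omega⟩
  rw [isotropic_eq, vonNeumannEntropy_smul_one_add_smul_proj isHermitian_maxEntangled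
    maxEntangled_mul_self trace_maxEntangled]
  simp [sq]

/-! ### States after a measurement -/

variable {X : Type*} [Fintype X] [DecidableEq X]

theorem postMeasurement_apply (Λ : X → Matrix (Fin d) (Fin d) ℂ)
    (ρ : Matrix (Fin d × Fin d) (Fin d × Fin d) ℂ) (p q : X × Fin d) :
    postMeasurement Λ ρ p q
      = if p.1 = q.1 then traceFst ((Λ p.1 ⊗ₖ (1 : Matrix (Fin d) (Fin d) ℂ)) * ρ) p.2 q.2
        else 0 :=
  sum_single_kronecker_apply _ p q

theorem traceFst_postMeasurement {Λ : X → Matrix (Fin d) (Fin d) ℂ} (hΛ : IsPOVM Λ)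
    (ρ : Matrix (Fin d × Fin d) (Fin d × Fin d) ℂ) :
    traceFst (postMeasurement Λ ρ) = traceFst ρ := by
  ext b b'
  have h : ∑ x, (Λ x ⊗ₖ (1 : Matrix (Fin d) (Fin d) ℂ)) = 1 := by
    rw [← one_kronecker_one, ← hΛ.sum_eq_one]
    ext p q
    simp [Matrix.sum_apply, kroneckerMap_apply, Finset.sum_mul]
  conv_rhs => rw [← one_mul ρ, ← h, Finset.sum_mul]
  simp only [traceFst, of_apply, Matrix.sum_apply, postMeasurement_apply, if_true]
  rw [Finset.sum_comm]

theorem traceSnd_postMeasurement (Λ : X → Matrix (Fin d) (Fin d) ℂ)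
    (ρ : Matrix (Fin d × Fin d) (Fin d × Fin d) ℂ) :
    traceSnd (postMeasurement Λ ρ)
      = diagonal fun x => (traceFst ((Λ x ⊗ₖ (1 : Matrix (Fin d) (Fin d) ℂ)) * ρ)).trace := by
  ext x y
  by_cases h : x = y
  · simp [traceSnd, postMeasurement_apply, trace, h]
  · simp [traceSnd, postMeasurement_apply, h]

/-! ### Entropies after a measurement of the isotropic state -/


/-- The value of `-∑ x log x` (natural logarithm) over the eigenvalues of the unnormalised state
`Tr_A((|v⟩⟨v| ⊗ I) ω)` of the memory, for a unit vector `v` and the isotropic state `ω`. With `μ`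
the noise weight, these are `μ + (λ - μ) / d`, once, and `μ`, with multiplicity `d - 1`. -/
noncomputable def outcomeEntropy (d : ℕ) (lam : ℝ) : ℝ :=
  negMulLog (noiseWeight d lam + (lam - noiseWeight d lam) / d)
    + (d - 1) * negMulLog (noiseWeight d lam)

theorem traceFst_kronecker_one_mul_isotropic_of_trace_eq {M : Matrix (Fin d) (Fin d) ℂ} {t : ℝ}
    (ht : M.trace = t) :
    traceFst ((M ⊗ₖ (1 : Matrix (Fin d) (Fin d) ℂ)) * isotropic d lam)
      = ((t * noiseWeight d lam : ℝ) : ℂ) • (1 : Matrix (Fin d) (Fin d) ℂ)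
        + (((lam - noiseWeight d lam) / d : ℝ) : ℂ) • Mᵀ := by
  rw [traceFst_kronecker_one_mul_isotropic, ht, Complex.ofReal_mul]

theorem isHermitian_smul_one_add_smul {A : Type*} [Fintype A] [DecidableEq A]
    {H : Matrix A A ℂ} (hH : H.IsHermitian) (a b : ℝ) :
    ((a : ℂ) • (1 : Matrix A A ℂ) + (b : ℂ) • H).IsHermitian := by
  simp [IsHermitian, conjTranspose_smul, hH.eq]

theorem vonNeumannEntropy_postMeasurement_isotropic {X : Type*} [Fintype X] [DecidableEq X]
    {Λ : X → Matrix (Fin d) (Fin d) ℂ} (hΛ : ∀ x, (Λ x).IsHermitian) {t : X → ℝ}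
    (ht : ∀ x, (Λ x).trace = t x) :
    vonNeumannEntropy (postMeasurement Λ (isotropic d lam))
      = ∑ x, vonNeumannEntropy
          (((t x * noiseWeight d lam : ℝ) : ℂ) • (1 : Matrix (Fin d) (Fin d) ℂ)
            + (((lam - noiseWeight d lam) / d : ℝ) : ℂ) • (Λ x)ᵀ) := by
  rw [postMeasurement]
  simp only [traceFst_kronecker_one_mul_isotropic_of_trace_eq (ht _)]
  exact vonNeumannEntropy_sum_single_kronecker fun x =>
    isHermitian_smul_one_add_smul (hΛ x).transpose _ _

theorem vonNeumannEntropy_postMeasurement_rankOne {X : Type*} [Fintype X] [DecidableEq X]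
    {v : X → EuclideanSpace ℂ (Fin d)} (hv : ∀ x, ‖v x‖ = 1) :
    vonNeumannEntropy (postMeasurement (rankOneMeasurement v) (isotropic d lam))
      = Fintype.card X * outcomeEntropy d lam / log 2 := by
  have hH : ∀ x, (rankOneMeasurement v x).IsHermitian := fun x =>
    (posSemidef_vecMulVec_self_star _).1
  rw [vonNeumannEntropy_postMeasurement_isotropic hH (t := fun _ => 1)
    (fun x => by simpa using trace_rankOneMeasurement (hv x))]
  have h : ∀ x, vonNeumannEntropy
      (((1 * noiseWeight d lam : ℝ) : ℂ) • (1 : Matrix (Fin d) (Fin d) ℂ)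
        + (((lam - noiseWeight d lam) / d : ℝ) : ℂ) • (rankOneMeasurement v x)ᵀ)
      = outcomeEntropy d lam / log 2 := by
    intro x
    rw [one_mul, vonNeumannEntropy_smul_one_add_smul_proj (hH x).transpose
      (by rw [← transpose_mul, rankOneMeasurement_mul_self (hv x)])
      (by rw [trace_transpose, trace_rankOneMeasurement (hv x)]), outcomeEntropy, Fintype.card_fin]
  simp only [h, Finset.sum_const, Finset.card_univ, nsmul_eq_mul, mul_div_assoc]

theorem uncertainty_rankOneMeasurement (hd : 2 ≤ d) {v : Fin d → EuclideanSpace ℂ (Fin d)}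
    (hv : ∀ x, ‖v x‖ = 1) :
    uncertainty (rankOneMeasurement v) (isotropic d lam)
      = (d * outcomeEntropy d lam - log d) / log 2 := by
  rw [uncertainty, vonNeumannEntropy_postMeasurement_rankOne hv, traceFst_isotropic hd,
    vonNeumannEntropy_maximallyMixed hd, Fintype.card_fin, sub_div]

/-! ### Classical correlation of the isotropic state -/

theorem vonNeumannEntropy_traceSnd_postMeasurement_isotropic (hd : 2 ≤ d) {X : Type*} [Fintype X]
    [DecidableEq X] {Λ : X → Matrix (Fin d) (Fin d) ℂ} {t : X → ℝ}
    (ht : ∀ x, (Λ x).trace = t x) :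
    vonNeumannEntropy (traceSnd (postMeasurement Λ (isotropic d lam)))
      = (∑ x, negMulLog (t x * (1 / d))) / log 2 := by
  rw [traceSnd_postMeasurement, ← vonNeumannEntropy_diagonal]
  congr 2
  ext x
  rw [traceFst_kronecker_one_mul_isotropic, trace_add, trace_smul, trace_smul, trace_one,
    trace_transpose, ht, ← d_mul_noiseWeight_add (lam := lam) hd, Fintype.card_fin]
  simp only [smul_eq_mul]
  push_cast
  ring

theorem mutualInfo_postMeasurement_isotropic (hd : 2 ≤ d) {X : Type*} [Fintype X]
    [DecidableEq X] {Λ : X → Matrix (Fin d) (Fin d) ℂ} (hΛ : IsPOVM Λ) {t : X → ℝ}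
    (ht : ∀ x, (Λ x).trace = t x) :
    mutualInfo (postMeasurement Λ (isotropic d lam))
      = (∑ x, negMulLog (t x * (1 / d)) + log d) / log 2
        - vonNeumannEntropy (postMeasurement Λ (isotropic d lam)) := by
  rw [mutualInfo, vonNeumannEntropy_traceSnd_postMeasurement_isotropic hd ht,
    traceFst_postMeasurement hΛ, traceFst_isotropic hd, vonNeumannEntropy_maximallyMixed hd,
    add_div]

theorem mutualInfo_postMeasurement_orthonormalBasis (hd : 2 ≤ d)
    (e : OrthonormalBasis (Fin d) ℂ (EuclideanSpace ℂ (Fin d))) :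
    mutualInfo (postMeasurement (rankOneMeasurement e) (isotropic d lam))
      = (2 * log d - d * outcomeEntropy d lam) / log 2 := by
  have hd0 : (d : ℝ) ≠ 0 := by positivity
  have he := fun x => e.orthonormal.norm_eq_one x
  rw [mutualInfo_postMeasurement_isotropic hd (isPOVM_rankOneMeasurement e) (t := fun _ => 1)
    (fun x => by simpa using trace_rankOneMeasurement (he x)),
    vonNeumannEntropy_postMeasurement_rankOne he]
  simp only [one_mul, negMulLog, Finset.sum_const, Finset.card_univ, Fintype.card_fin,
    nsmul_eq_mul, one_div, log_inv]
  field_simp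
  ring

/-- No measurement of one half of the isotropic state reveals more about the other half than an
orthonormal basis does. The entropy of the outcome register cancels against the part of the joint
entropy that depends on the weights `tr Λ x`. -/
theorem mutualInfo_postMeasurement_isotropic_le (hd : 2 ≤ d) (hlam0 : 0 ≤ lam) (hlam1 : lam ≤ 1)
    {X : Type*} [Fintype X] [DecidableEq X] {Λ : X → Matrix (Fin d) (Fin d) ℂ} (hΛ : IsPOVM Λ) :
    mutualInfo (postMeasurement Λ (isotropic d lam))
      ≤ (2 * log d - d * outcomeEntropy d lam) / log 2 := by
  have hd0 : (d : ℝ) ≠ 0 := by positivity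
  set t : X → ℝ := fun x => ∑ i, (hΛ.posSemidef x).1.eigenvalues i with ht_def
  have ht : ∀ x, (Λ x).trace = t x := fun x => by
    simpa [ht_def] using (hΛ.posSemidef x).1.trace_eq_sum_eigenvalues
  have hsum : ∑ x, t x = d := by
    have h := congrArg trace hΛ.sum_eq_one
    rw [trace_sum, trace_one, Fintype.card_fin] at h
    simp only [ht] at h
    exact_mod_cast h
  have hμ := noiseWeight_nonneg hd hlam1
  have hab : 0 ≤ noiseWeight d lam + (lam - noiseWeight d lam) / d := by
    rw [noiseWeight_add hd]
    positivity
  -- Rewriting by `negMulLog_mul` splits off the part `negMulLog (t x) / d`, because the eigenvalues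
  -- of the outcome state of a rank-one projection sum to `1 / d`.
  have hle : ∀ x, (t x * outcomeEntropy d lam + negMulLog (t x) / d) / log 2
      ≤ vonNeumannEntropy
          (((t x * noiseWeight d lam : ℝ) : ℂ) • (1 : Matrix (Fin d) (Fin d) ℂ)
            + (((lam - noiseWeight d lam) / d : ℝ) : ℂ) • (Λ x)ᵀ) := by
    intro x
    refine le_trans (le_of_eq ?_) (le_vonNeumannEntropy_smul_one_add_smul
      (hΛ.posSemidef x).transpose (by rw [trace_transpose, ht]) hμ hab)
    have hw : noiseWeight d lam + (lam - noiseWeight d lam) / d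
        + (d - 1) * noiseWeight d lam = 1 / d := by
      rw [← d_mul_noiseWeight_add (lam := lam) hd]
      ring
    rw [negMulLog_mul, negMulLog_mul, outcomeEntropy, Fintype.card_fin,
      div_eq_mul_one_div (negMulLog (t x)) (d : ℝ), ← hw]
    ring
  rw [mutualInfo_postMeasurement_isotropic hd hΛ ht,
    vonNeumannEntropy_postMeasurement_isotropic (fun x => (hΛ.posSemidef x).1) ht]
  refine (sub_le_sub_left (Finset.sum_le_sum fun x _ => hle x) _).trans (le_of_eq ?_)
  simp only [negMulLog_mul, Finset.sum_add_distrib, ← Finset.sum_div, ← Finset.sum_mul,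
    ← Finset.mul_sum, hsum]
  rw [negMulLog, one_div, log_inv]
  field_simp
  ring

theorem isGreatest_accessibleInfo_isotropic (hd : 2 ≤ d) (hlam0 : 0 ≤ lam) (hlam1 : lam ≤ 1) :
    IsGreatest (accessibleInfo (isotropic d lam))
      ((2 * log d - d * outcomeEntropy d lam) / log 2) := by
  refine ⟨⟨d, _, isPOVM_rankOneMeasurement (EuclideanSpace.basisFun (Fin d) ℂ),
    (mutualInfo_postMeasurement_orthonormalBasis hd _).symm⟩, ?_⟩
  rintro _ ⟨n, Υ, hΥ, rfl⟩
  exact mutualInfo_postMeasurement_isotropic_le hd hlam0 hlam1 hΥ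

/-! ### Entropy comparison -/

/-- Gibbs' inequality for a single pair of weights. -/
theorem negMulLog_le_of_pos {x y : ℝ} (hx : 0 ≤ x) (hy : 0 < y) :
    negMulLog x ≤ -(x * log y) + y - x := by
  rcases hx.eq_or_lt with rfl | hx
  · simpa using hy.le
  · have h := mul_le_mul_of_nonneg_left (log_le_sub_one_of_pos (div_pos hy hx)) hx.le
    rw [log_div hy.ne' hx.ne', mul_sub, mul_sub, mul_div_cancel₀ _ hx.ne'] at h
    rw [negMulLog]
    linarith

/-- Subadditivity of the Shannon entropy for the distribution on `d × d` points that gives the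
weight `x` to one point and `y` to each of the others: both marginals give the weight `x + (d-1) y`
to one point and `d y` to each of the others. -/
theorem negMulLog_add_le_two_mul {n x y : ℝ} (hn : 1 ≤ n) (hx : 0 ≤ x) (hy : 0 ≤ y)
    (hxy : x + (n ^ 2 - 1) * y = 1) :
    negMulLog x + (n ^ 2 - 1) * negMulLog y
      ≤ 2 * (negMulLog (x + (n - 1) * y) + (n - 1) * negMulLog (n * y)) := by
  set q := x + (n - 1) * y with hq
  set r := n * y with hr
  have hqr : q + (n - 1) * r = 1 := by
    refine Eq.trans ?_ hxy
    rw [hq, hr]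
    ring
  have hq0 : 0 < q := by
    rcases hy.eq_or_lt with h | h
    · rw [← h] at hxy
      rw [hq, ← h]
      linarith
    · rcases hx.eq_or_lt with h' | h'
      · have : n ≠ 1 := by
          rintro rfl
          rw [← h'] at hxy
          norm_num at hxy
        have : 0 < n - 1 := sub_pos.2 (lt_of_le_of_ne hn this.symm)
        positivity
      · have : 0 ≤ n - 1 := sub_nonneg.2 hn
        positivity
  -- Compare each point with the product of its marginal weights: `q * q` for the point `x`, `q * r`
  -- for the `2 (n - 1)` points on the two axes, `r * r` for the remaining `(n - 1) ^ 2`. Where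
  -- `y = 0` also `r = 0`, and the comparison is trivial.
  have h1 := negMulLog_le_of_pos hx (mul_pos hq0 hq0)
  have h2 : negMulLog y ≤ -(y * (log q + log r)) + q * r - y := by
    rcases hy.eq_or_lt with h | h
    · simp [hr, ← h]
    · have hr0 : 0 < r := mul_pos (by linarith) h
      rw [← log_mul hq0.ne' hr0.ne']
      exact negMulLog_le_of_pos hy (mul_pos hq0 hr0)
  have h3 : negMulLog y ≤ -(y * (log r + log r)) + r * r - y := by
    rcases hy.eq_or_lt with h | h
    · simp [hr, ← h]
    · have hr0 : 0 < r := mul_pos (by linarith) h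
      rw [← log_mul hr0.ne' hr0.ne']
      exact negMulLog_le_of_pos hy (mul_pos hr0 hr0)
  rw [log_mul hq0.ne' hq0.ne'] at h1
  have hn0 : 0 ≤ n - 1 := sub_nonneg.2 hn
  have h2' := mul_le_mul_of_nonneg_left h2 (mul_nonneg two_pos.le hn0)
  have h3' := mul_le_mul_of_nonneg_left h3 (mul_nonneg hn0 hn0)
  -- The linear terms cancel since both distributions have total weight one.
  have e1 : -(x * (log q + log q)) + q * q - x
      + 2 * (n - 1) * (-(y * (log q + log r)) + q * r - y)
      + (n - 1) * (n - 1) * (-(y * (log r + log r)) + r * r - y)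
      = 2 * (negMulLog q + (n - 1) * negMulLog r)
        + ((q + (n - 1) * r) ^ 2 - (x + (n ^ 2 - 1) * y)) := by
    simp only [negMulLog]
    generalize log q = a
    generalize log r = b
    rw [hq, hr]
    ring
  rw [hqr, hxy] at e1
  linarith

/-- Rescaling the `d` equiprobable outcome states to unit trace costs `log d`. -/
theorem mul_outcomeEntropy (hd : 2 ≤ d) :
    d * outcomeEntropy d lam
      = negMulLog ((d * lam + 1) / (d + 1)) + (d - 1) * negMulLog (d * noiseWeight d lam)
        + log d := by
  have hd0 : (0 : ℝ) < d := by positivity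
  have hw := noiseWeight_mul (lam := lam) hd
  have h1 : (d * lam + 1) / (d + 1) + (d - 1) * (d * noiseWeight d lam) = 1 := by
    field_simp
    linear_combination (d : ℝ) * hw
  have h2 : ∀ z : ℝ, d * negMulLog (z / d) = negMulLog z + z * log d := by
    intro z
    rw [div_eq_mul_inv, negMulLog_mul]
    simp only [negMulLog, log_inv]
    field_simp
  have h3 := h2 (d * noiseWeight d lam)
  rw [mul_div_cancel_left₀ _ hd0.ne'] at h3
  rw [outcomeEntropy, noiseWeight_add hd, mul_add, h2, mul_left_comm, h3]
  linear_combination log d * h1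

/-- The weights of the isotropic state on the `d²` Bell states form a joint distribution whose two
marginals are both the spectrum of a normalised outcome state, so this is subadditivity.
It makes discord minus classical correlation nonnegative. -/
theorem entropy_isotropic_le (hd : 2 ≤ d) (hlam0 : 0 ≤ lam) (hlam1 : lam ≤ 1) :
    negMulLog lam + ((d : ℝ) ^ 2 - 1) * negMulLog (noiseWeight d lam)
      ≤ 2 * (d * outcomeEntropy d lam - log d) := by
  have hw := noiseWeight_mul (lam := lam) hd
  have hd1 : (1 : ℝ) ≤ d := by exact_mod_cast one_le_two.trans hd
  have h := negMulLog_add_le_two_mul hd1 hlam0 (noiseWeight_nonneg hd hlam1) (by linarith)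
  have hq : lam + (d - 1) * noiseWeight d lam = (d * lam + 1) / (d + 1) := by
    rw [eq_div_iff (by positivity)]
    linear_combination hw
  rw [hq] at h
  rw [mul_outcomeEntropy hd]
  linarith

end Isotropic

end QMemory

theorem mainTheorem4 (d : ℕ) (hd : 2 ≤ d) (lam : ℝ) (hlam0 : 0 ≤ lam) (hlam1 : lam ≤ 1)
    (e : OrthonormalBasis (Fin d) ℂ (EuclideanSpace ℂ (Fin d)))
    (f : Fin d → EuclideanSpace ℂ (Fin d)) (hf : f = QMemory.fourierConjugate e)
    (P Q : Fin d → Matrix (Fin d) (Fin d) ℂ)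
    (hP : P = QMemory.rankOneMeasurement e) (hQ : Q = QMemory.rankOneMeasurement f)
    (ω : Matrix (Fin d × Fin d) (Fin d × Fin d) ℂ) (hω : ω = QMemory.isotropic d lam)
    (v : ℝ)
    (hv : v = -(2 * (d * lam + 1) / (d + 1)) * Real.logb 2 ((d * lam + 1) / (d + 1))
      - 2 * d * (1 - lam) / (d + 1) * Real.logb 2 (d * (1 - lam) / ((d : ℝ) ^ 2 - 1))) :
    -- the maximum that defines the classical correlation is attained
    IsGreatest (QMemory.accessibleInfo ω) (QMemory.classicalCorrelation ω) ∧
    -- the uncertainty sum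
    QMemory.uncertainty P ω + QMemory.uncertainty Q ω = v ∧
    -- the new lower bound, without and with the maximum with zero
    -2 * Real.logb 2 (QMemory.incompatibility e f) + QMemory.condEntropy ω
      + QMemory.discord ω - QMemory.classicalCorrelation ω = v ∧
    -2 * Real.logb 2 (QMemory.incompatibility e f) + QMemory.condEntropy ω
      + max 0 (QMemory.discord ω - QMemory.classicalCorrelation ω) = v ∧
    -- the lower bound of Berta et al.
    -2 * Real.logb 2 (QMemory.incompatibility e f) + QMemory.condEntropy ω
      = -lam * Real.logb 2 lam - (1 - lam) * Real.logb 2 ((1 - lam) / ((d : ℝ) ^ 2 - 1)) := by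
  open QMemory in
  subst hf hP hQ hω
  have : NeZero d := ⟨by omega⟩
  have hd0 : (0 : ℝ) < d := by positivity
  have hlog : 0 < Real.log 2 := Real.log_pos one_lt_two
  have hw := noiseWeight_mul (lam := lam) hd
  have hJ := isGreatest_accessibleInfo_isotropic hd hlam0 hlam1
  have hJ' : classicalCorrelation (isotropic d lam)
      = (2 * Real.log d - d * outcomeEntropy d lam) / Real.log 2 := hJ.csSup_eq
  have hc : -2 * Real.logb 2 (incompatibility e (fourierConjugate e))
      = Real.log d / Real.log 2 := by
    rw [incompatibility_fourierConjugate, Real.logb, one_div, Real.log_inv,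
      Real.log_sqrt hd0.le]
    ring
  have hS : condEntropy (isotropic d lam)
      = (Real.negMulLog lam + ((d : ℝ) ^ 2 - 1) * Real.negMulLog (noiseWeight d lam)) / Real.log 2
        - Real.log d / Real.log 2 := by
    rw [condEntropy, vonNeumannEntropy_isotropic hd, traceFst_isotropic hd,
      vonNeumannEntropy_maximallyMixed hd]
  have hI : mutualInfo (isotropic d lam) = Real.log d / Real.log 2 + Real.log d / Real.log 2
      - (Real.negMulLog lam + ((d : ℝ) ^ 2 - 1) * Real.negMulLog (noiseWeight d lam))
        / Real.log 2 := by
    rw [mutualInfo, vonNeumannEntropy_isotropic hd, traceFst_isotropic hd, traceSnd_isotropic hd,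
      vonNeumannEntropy_maximallyMixed hd]
  have hv' : v = 2 * (d * outcomeEntropy d lam - Real.log d) / Real.log 2 := by
    have h1 : d * (1 - lam) / ((d : ℝ) ^ 2 - 1) = d * noiseWeight d lam := mul_div_assoc _ _ _
    have h2 : 2 * d * (1 - lam) / (d + 1) = 2 * (d - 1) * (d * noiseWeight d lam) := by
      rw [div_eq_iff (by positivity), ← hw]
      ring
    rw [hv, h1, h2, mul_outcomeEntropy hd]
    simp only [Real.negMulLog, Real.logb]
    ring
  have hDJ : 0 ≤ discord (isotropic d lam) - classicalCorrelation (isotropic d lam) := by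
    have h := div_le_div_of_nonneg_right (entropy_isotropic_le hd hlam0 hlam1) hlog.le
    rw [discord, hI, hJ']
    ring_nf at h ⊢
    linarith
  have hbound : -2 * Real.logb 2 (incompatibility e (fourierConjugate e))
      + condEntropy (isotropic d lam) + discord (isotropic d lam)
      - classicalCorrelation (isotropic d lam) = v := by
    rw [hc, hS, discord, hI, hJ', hv']
    ring
  refine ⟨hJ'.symm ▸ hJ, ?_, hbound, ?_, ?_⟩
  · rw [uncertainty_rankOneMeasurement hd fun x => e.orthonormal.norm_eq_one x,
      uncertainty_rankOneMeasurement hd (norm_fourierConjugate e), hv']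
    ring
  · rw [max_eq_right hDJ, ← hbound]
    ring
  · rw [hc, hS, ← noiseWeight, ← hw]
    simp only [Real.negMulLog, Real.logb]
    ring
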